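/- Let $S$ be an inverse semigroup with zero, ordered by its natural partial order ($s\le t$ iff $s=te$ for some idempotent $e$). Call $s,t$ compatible if $s^{-1}t$ and $st^{-1}$ are idempotents. An inverse semigroup with zero is *distributive* if every compatible pair of elements has a join and multiplication distributes over these joins on both sides. Let $\mathsf{D}(S)$ be the distributive inverse semigroup, under subset multiplication, of all order ideals $\{a_1,\dots,a_m\}^{\downarrow}=\{s\in S: s\le a_i \text{ for some } i\}$ with $m\ge 1$ and $a_1,\dots,a_m\in S$ pairwise compatible. For a distributive inverse semigroup $T$, a *prime filter* is a non-empty, upward closed, downward directed subset $A\subseteq T$ with $0\notin A$ such that $a\vee b\in A$ implies $a\in A$ or $b\in A$. With $\mathbf{d}(A)=(A^{-1}A)^{\uparrow}$, $\mathbf{r}(A)=(AA^{-1})^{\uparrow}$ and $A\cdot B=(AB)^{\uparrow}$, defined when $\mathbf{d}(A)=\mathbf{r}(B)$, the prime filters of $T$ form a groupoid $\mathsf{G}(T)$. The partial bisections of $\mathsf{G}(T)$ (the sets of prime filters on which both $\mathbf{d}$ and $\mathbf{r}$ are injective) form an inverse semigroup $\mathsf{L}(\mathsf{G}(T))$ under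 subset multiplication. For $t\le s$ in $T$ let $V_{s;t}\in\mathsf{L}(\mathsf{G}(T))$ be the set of prime filters containing $s$ and omitting $t$, and let $\mathsf{V}(T)^{\vee}$ be the inverse subsemigroup of $\mathsf{L}(\mathsf{G}(T))$ of all unions of finite compatible sets of elements $V_{s;t}$. The *Booleanization* of $S$ is the inverse semigroup $\mathsf{B}(S)=\mathsf{V}(\mathsf{D}(S))^{\vee}$. Then $S$ is a weak semilattice (that is, for all $a,b\in S$ there is a finite set $F\subseteq S$ with $a^{\downarrow}\cap b^{\downarrow}=F^{\downarrow}$) if and only if $\mathsf{B}(S)$ has all binary meets with respect to its natural partial order. -/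

import Mathlib

/-- An inverse semigroup with zero: every `a` has exactly one generalized inverse `a⁻¹`. -/
class InverseSemigroupWithZero (S : Type*) extends SemigroupWithZero S, Inv S where
  mul_inv_mul : ∀ a : S, a * a⁻¹ * a = a
  inv_mul_inv : ∀ a : S, a⁻¹ * a * a⁻¹ = a⁻¹
  inv_unique : ∀ a b : S, a * b * a = a → b * a * b = b → b = a⁻¹

namespace InverseSemigroupWithZero

/-- A criterion for uniqueness of generalized inverses. -/
theorem unique_of_proj {S : Type*} [Semigroup S] [Inv S]
    (h1 : ∀ a : S, a * a⁻¹ * a = a) (h2 : ∀ a : S, a⁻¹⁻¹ = a)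
    (h3 : ∀ a b : S, a * a⁻¹ * (b * b⁻¹) = b * b⁻¹ * (a * a⁻¹)) :
    ∀ a b : S, a * b * a = a → b * a * b = b → b = a⁻¹ := by
  have h1' : ∀ a : S, a⁻¹ * a * a⁻¹ = a⁻¹ := fun a => by
    have := h1 a⁻¹
    rwa [h2] at this
  have h4 : ∀ p : S, p * p = p → p * p⁻¹ = p := by
    intro p hp
    have hc : p⁻¹ * p * (p * p⁻¹) = p * p⁻¹ * (p⁻¹ * p) := by
      have := h3 p⁻¹ p
      rwa [h2] at this
    have e1 : p⁻¹ = p⁻¹ * p * (p * p⁻¹) := by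
      calc p⁻¹ = p⁻¹ * p * p⁻¹ := (h1' p).symm
        _ = p⁻¹ * (p * p) * p⁻¹ := by rw [hp]
        _ = _ := by simp only [mul_assoc]
    have e2 : p⁻¹ = p * p⁻¹ * (p⁻¹ * p) := e1.trans hc
    have e3 : p⁻¹ * p⁻¹ = p⁻¹ := by
      have hi : p⁻¹ * p * (p⁻¹ * p) = p⁻¹ * p := by rw [← mul_assoc, h1']
      have hj : p * p⁻¹ * (p * p⁻¹) = p * p⁻¹ := by rw [← mul_assoc, h1]
      calc p⁻¹ * p⁻¹ = (p⁻¹ * p * (p * p⁻¹)) * (p * p⁻¹ * (p⁻¹ * p)) := by rw [← e2, ← e1]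
        _ = p⁻¹ * p * (p * p⁻¹ * (p * p⁻¹)) * (p⁻¹ * p) := by simp only [mul_assoc]
        _ = p⁻¹ * p * (p * p⁻¹ * (p⁻¹ * p)) := by rw [hj]; simp only [mul_assoc]
        _ = p⁻¹ * p * (p⁻¹ * p * (p * p⁻¹)) := by rw [hc]
        _ = p⁻¹ * p * (p⁻¹ * p) * (p * p⁻¹) := by simp only [mul_assoc]
        _ = p⁻¹ := by rw [hi, ← e1]
    have e4 : p = p⁻¹ := by
      calc p = p * p⁻¹ * p := (h1 p).symm
        _ = p * (p⁻¹ * p⁻¹) * p := by rw [e3]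
        _ = p * p⁻¹ * (p⁻¹ * p) := by simp only [mul_assoc]
        _ = p⁻¹ := e2.symm
    calc p * p⁻¹ = p * p := by rw [← e4]
      _ = p := hp
  have h5 : ∀ p q : S, p * p = p → q * q = q → p * q = q * p := by
    intro p q hp hq
    have := h3 p q
    rwa [h4 p hp, h4 q hq] at this
  intro a b hab hba
  have i1 : a * b * (a * b) = a * b := by rw [← mul_assoc, hab]
  have i2 : a * a⁻¹ * (a * a⁻¹) = a * a⁻¹ := by rw [← mul_assoc, h1]
  have i3 : b * a * (b * a) = b * a := by rw [← mul_assoc, hba]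
  have i4 : a⁻¹ * a * (a⁻¹ * a) = a⁻¹ * a := by rw [← mul_assoc, h1']
  have l1 : b = b * a * a⁻¹ := by
    calc b = b * a * b := hba.symm
      _ = b * (a * a⁻¹ * a) * b := by rw [h1]
      _ = b * (a * a⁻¹ * (a * b)) := by simp only [mul_assoc]
      _ = b * (a * b * (a * a⁻¹)) := by rw [h5 _ _ i2 i1]
      _ = b * a * b * a * a⁻¹ := by simp only [mul_assoc]
      _ = b * a * a⁻¹ := by rw [hba]
  have l2 : b * a * a⁻¹ = a⁻¹ := by
    calc b * a * a⁻¹ = b * (a * a⁻¹ * a) * a⁻¹ := by rw [h1]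
      _ = b * a * (a⁻¹ * a) * a⁻¹ := by simp only [mul_assoc]
      _ = a⁻¹ * a * (b * a) * a⁻¹ := by rw [h5 _ _ i3 i4]
      _ = a⁻¹ * (a * b * a) * a⁻¹ := by simp only [mul_assoc]
      _ = a⁻¹ := by rw [hab, h1']
  exact l1.trans l2

section Basic

variable {S : Type*} [InverseSemigroupWithZero S]

theorem idem_mul_idem {e f : S} (he : e * e = e) (hf : f * f = f) : e * f * (e * f) = e * f := by
  have hx : f * (e * f)⁻¹ * e = (e * f)⁻¹ := by
    apply inv_unique
    · calc e * f * (f * (e * f)⁻¹ * e) * (e * f)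
          = e * (f * f) * (e * f)⁻¹ * ((e * e) * f) := by simp only [mul_assoc]
        _ = e * f * (e * f)⁻¹ * (e * f) := by rw [he, hf]
        _ = _ := mul_inv_mul _
    · calc f * (e * f)⁻¹ * e * (e * f) * (f * (e * f)⁻¹ * e)
          = f * ((e * f)⁻¹ * ((e * e) * (f * f)) * (e * f)⁻¹) * e := by simp only [mul_assoc]
        _ = _ := by rw [he, hf, inv_mul_inv]
  have hxx : (e * f)⁻¹ * (e * f)⁻¹ = (e * f)⁻¹ := by
    calc (e * f)⁻¹ * (e * f)⁻¹ = (f * (e * f)⁻¹ * e) * (f * (e * f)⁻¹ * e) := by rw [hx]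
      _ = f * ((e * f)⁻¹ * (e * f) * (e * f)⁻¹) * e := by simp only [mul_assoc]
      _ = _ := by rw [inv_mul_inv, hx]
  have h1 : e * f = (e * f)⁻¹⁻¹ := inv_unique _ _ (inv_mul_inv _) (mul_inv_mul _)
  have h2 : (e * f)⁻¹ = (e * f)⁻¹⁻¹ := inv_unique _ _ (by rw [hxx, hxx]) (by rw [hxx, hxx])
  rw [h1, ← h2, hxx]

theorem idem_comm {e f : S} (he : e * e = e) (hf : f * f = f) : e * f = f * e := by
  have h1 := idem_mul_idem he hf
  have h2 := idem_mul_idem hf he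
  have a1 : f * e = (e * f)⁻¹ := by
    apply inv_unique
    · calc e * f * (f * e) * (e * f) = e * (f * f) * ((e * e) * f) := by simp only [mul_assoc]
        _ = _ := by rw [he, hf, h1]
    · calc f * e * (e * f) * (f * e) = f * (e * e) * ((f * f) * e) := by simp only [mul_assoc]
        _ = _ := by rw [he, hf, h2]
  have a2 : e * f = (e * f)⁻¹ := inv_unique _ _ (by rw [h1, h1]) (by rw [h1, h1])
  rw [a1, ← a2]

theorem inv_inv' (a : S) : a⁻¹⁻¹ = a := (inv_unique _ _ (inv_mul_inv a) (mul_inv_mul a)).symm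

theorem idem_inv {e : S} (he : e * e = e) : e⁻¹ = e :=
  (inv_unique _ _ (by rw [he, he]) (by rw [he, he])).symm

theorem inv_mul_self_idem (a : S) : a⁻¹ * a * (a⁻¹ * a) = a⁻¹ * a := by
  rw [← mul_assoc, inv_mul_inv]

theorem mul_inv_self_idem (a : S) : a * a⁻¹ * (a * a⁻¹) = a * a⁻¹ := by
  rw [← mul_assoc, mul_inv_mul]

theorem mul_inv_rev' (a b : S) : (a * b)⁻¹ = b⁻¹ * a⁻¹ := by
  have hc := idem_comm (mul_inv_self_idem b) (inv_mul_self_idem a)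
  symm
  apply inv_unique
  · calc a * b * (b⁻¹ * a⁻¹) * (a * b) = a * (b * b⁻¹ * (a⁻¹ * a)) * b := by simp only [mul_assoc]
      _ = (a * a⁻¹ * a) * (b * b⁻¹ * b) := by rw [hc]; simp only [mul_assoc]
      _ = _ := by rw [mul_inv_mul, mul_inv_mul]
  · calc b⁻¹ * a⁻¹ * (a * b) * (b⁻¹ * a⁻¹)
        = b⁻¹ * (a⁻¹ * a * (b * b⁻¹)) * a⁻¹ := by simp only [mul_assoc]
      _ = (b⁻¹ * b * b⁻¹) * (a⁻¹ * a * a⁻¹) := by rw [← hc]; simp only [mul_assoc]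
      _ = _ := by rw [inv_mul_inv, inv_mul_inv]

theorem conj_idem (a : S) {e : S} (he : e * e = e) : a * e * a⁻¹ * (a * e * a⁻¹) = a * e * a⁻¹ := by
  calc a * e * a⁻¹ * (a * e * a⁻¹) = a * (e * (a⁻¹ * a)) * e * a⁻¹ := by simp only [mul_assoc]
    _ = a * a⁻¹ * a * (e * e) * a⁻¹ := by
      rw [idem_comm he (inv_mul_self_idem a)]; simp only [mul_assoc]
    _ = _ := by rw [mul_inv_mul, he]

/-- The natural partial order: `s ≤ t` if and only if `s = t * e` for some idempotent `e`. -/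
instance : PartialOrder S where
  le s t := ∃ e : S, e * e = e ∧ s = t * e
  le_refl s := ⟨s⁻¹ * s, inv_mul_self_idem s, by rw [← mul_assoc, mul_inv_mul]⟩
  le_trans a b c := by
    rintro ⟨e, he, rfl⟩ ⟨f, hf, rfl⟩
    exact ⟨f * e, idem_mul_idem hf he, mul_assoc _ _ _⟩
  le_antisymm a b := by
    rintro ⟨e, he, h1⟩ ⟨f, hf, h2⟩
    have h3 : a * e = a := by rw [h1, mul_assoc, he]
    calc a = b * e := h1
      _ = a * f * e := by rw [← h2]
      _ = a * e * f := by rw [mul_assoc, idem_comm hf he, ← mul_assoc]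
      _ = b := by rw [h3, ← h2]

theorem le_def {s t : S} : s ≤ t ↔ ∃ e : S, e * e = e ∧ s = t * e := Iff.rfl

theorem mul_idem_le (t : S) {e : S} (he : e * e = e) : t * e ≤ t := ⟨e, he, rfl⟩

theorem idem_mul_le (t : S) {e : S} (he : e * e = e) : e * t ≤ t := by
  refine ⟨t⁻¹ * e * t, by simpa only [inv_inv'] using conj_idem t⁻¹ he, ?_⟩
  calc e * t = e * (t * t⁻¹) * t := by rw [mul_assoc, mul_inv_mul]
    _ = t * t⁻¹ * e * t := by rw [idem_comm he (mul_inv_self_idem t)]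
    _ = _ := by simp only [mul_assoc]

theorem le_iff_left {s t : S} : s ≤ t ↔ ∃ e : S, e * e = e ∧ s = e * t := by
  constructor
  · rintro ⟨e, he, rfl⟩
    refine ⟨t * e * t⁻¹, conj_idem t he, ?_⟩
    calc t * e = t * t⁻¹ * t * e := by rw [mul_inv_mul]
      _ = t * (t⁻¹ * t * e) := by simp only [mul_assoc]
      _ = _ := by rw [idem_comm (inv_mul_self_idem t) he]; simp only [mul_assoc]
  · rintro ⟨e, he, rfl⟩
    exact idem_mul_le t he

theorem mul_le_mul'' {a b c d : S} (h1 : a ≤ b) (h2 : c ≤ d) : a * c ≤ b * d := by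
  obtain ⟨e, he, rfl⟩ := h1
  obtain ⟨f, hf, rfl⟩ := h2
  have : b * e * (d * f) = b * (e * d) * f := by simp only [mul_assoc]
  rw [this]
  refine (mul_idem_le _ hf).trans ?_
  obtain ⟨g, hg, h⟩ := idem_mul_le d he
  rw [h, ← mul_assoc]
  exact mul_idem_le _ hg

theorem inv_le_inv'' {a b : S} (h : a ≤ b) : a⁻¹ ≤ b⁻¹ := by
  obtain ⟨e, he, rfl⟩ := h
  rw [mul_inv_rev', idem_inv he]
  exact idem_mul_le _ he

theorem inv_mul_mul_le (a x : S) : a⁻¹ * (a * x) ≤ x := by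
  rw [← mul_assoc]; exact idem_mul_le _ (inv_mul_self_idem a)

theorem mul_inv_mul_le (a x : S) : a * (a⁻¹ * x) ≤ x := by
  rw [← mul_assoc]; exact idem_mul_le _ (mul_inv_self_idem a)

theorem mul_inv_mul_of_le {a x w : S} (h : w ≤ a * x) : a * (a⁻¹ * w) = w := by
  obtain ⟨e, _, rfl⟩ := h
  calc a * (a⁻¹ * (a * x * e)) = a * a⁻¹ * a * x * e := by simp only [mul_assoc]
    _ = _ := by rw [mul_inv_mul]

theorem idem_of_le {x e : S} (he : e * e = e) (h : x ≤ e) : x * x = x := by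
  obtain ⟨f, hf, rfl⟩ := h
  exact idem_mul_idem he hf

theorem zero_le' (a : S) : 0 ≤ a := ⟨0, zero_mul 0, (mul_zero a).symm⟩

theorem zero_inv' : (0 : S)⁻¹ = 0 := idem_inv (zero_mul 0)

/-- The compatibility relation. -/
def Compatible (s t : S) : Prop :=
  IsIdempotentElem (s⁻¹ * t) ∧ IsIdempotentElem (s * t⁻¹)

theorem Compatible.inv {s t : S} (h : Compatible s t) : Compatible s⁻¹ t⁻¹ := by
  refine ⟨?_, ?_⟩
  · rw [inv_inv']; exact h.2
  · rw [inv_inv']; exact h.1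

theorem Compatible.mul {s t u v : S} (h : Compatible s t) (k : Compatible u v) :
    Compatible (s * u) (t * v) := by
  refine ⟨?_, ?_⟩
  · have e : (s * u)⁻¹ * (t * v) = u⁻¹ * (s⁻¹ * t * v) := by
      rw [mul_inv_rev']; simp only [mul_assoc]
    rw [e]
    exact idem_of_le k.1 (mul_le_mul'' le_rfl (idem_mul_le v h.1))
  · have e : s * u * (t * v)⁻¹ = s * (u * v⁻¹ * t⁻¹) := by
      rw [mul_inv_rev']; simp only [mul_assoc]
    rw [e]
    exact idem_of_le h.2 (mul_le_mul'' le_rfl (idem_mul_le _ k.2))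

theorem compatible_of_le {s t u : S} (h : s ≤ u) (k : t ≤ u) : Compatible s t :=
  ⟨idem_of_le (inv_mul_self_idem u) (mul_le_mul'' (inv_le_inv'' h) k),
    idem_of_le (mul_inv_self_idem u) (mul_le_mul'' h (inv_le_inv'' k))⟩

theorem Compatible.mono {s t u v : S} (h : Compatible u v) (hs : s ≤ u) (ht : t ≤ v) :
    Compatible s t :=
  ⟨idem_of_le h.1 (mul_le_mul'' (inv_le_inv'' hs) ht),
    idem_of_le h.2 (mul_le_mul'' hs (inv_le_inv'' ht))⟩

end Basic

/-- The order ideal `F^↓` generated by a set `F`. -/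
def downSet {S : Type*} [InverseSemigroupWithZero S] (F : Set S) : Set S :=
  {s | ∃ x ∈ F, s ≤ x}

/-- The upward closure `F^↑` of a set `F`. -/
def upSet {S : Type*} [InverseSemigroupWithZero S] (F : Set S) : Set S :=
  {s | ∃ x ∈ F, x ≤ s}

/-- `S` is a weak semilattice: the intersection of any two principal order ideals is
finitely generated (as an order ideal). -/
def IsWeakSemilattice (S : Type*) [InverseSemigroupWithZero S] : Prop :=
  ∀ a b : S, ∃ F : Set S, F.Finite ∧ downSet {a} ∩ downSet {b} = downSet F

/-- `S` is a `∧`-semigroup: it has all binary meets in the natural partial order. -/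
def IsMeetSemigroup (S : Type*) [InverseSemigroupWithZero S] : Prop :=
  ∀ a b : S, ∃ c : S, IsGLB {a, b} c

end InverseSemigroupWithZero

open InverseSemigroupWithZero

/-- A distributive inverse semigroup: compatible pairs have joins, and multiplication
distributes over these joins. -/
class DistributiveInverseSemigroup (S : Type*) extends InverseSemigroupWithZero S where
  exists_join : ∀ a b : S, Compatible a b → ∃ c : S, IsLUB {a, b} c
  mul_join : ∀ a b c x : S, Compatible a b → IsLUB {a, b} c → IsLUB {x * a, x * b} (x * c)
  join_mul : ∀ a b c x : S, Compatible a b → IsLUB {a, b} c → IsLUB {a * x, b * x} (c * x)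

/-! ### The distributive completion -/

/-- The elements of `D(S)`: the finitely generated compatible order ideals of `S`
(non-empty, hence containing `0`). -/
@[ext] structure DistributiveCompletion (S : Type*) [InverseSemigroupWithZero S] where
  carrier : Set S
  exists_generators : ∃ F : Set S, F.Finite ∧ F.Nonempty ∧
    (∀ a ∈ F, ∀ b ∈ F, Compatible a b) ∧ carrier = downSet F

namespace DistributiveCompletion

variable {S : Type*} [InverseSemigroupWithZero S]

theorem lower (A : DistributiveCompletion S) {x y : S} (h : x ≤ y) (hy : y ∈ A.carrier) :
    x ∈ A.carrier := by
  obtain ⟨F, -, -, -, hF⟩ := A.exists_generators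
  rw [hF] at hy ⊢
  obtain ⟨f, hf, hyf⟩ := hy
  exact ⟨f, hf, h.trans hyf⟩

theorem compat (A : DistributiveCompletion S) {x y : S} (hx : x ∈ A.carrier)
    (hy : y ∈ A.carrier) : Compatible x y := by
  obtain ⟨F, -, -, hc, hF⟩ := A.exists_generators
  rw [hF] at hx hy
  obtain ⟨f, hf, hxf⟩ := hx
  obtain ⟨g, hg, hyg⟩ := hy
  exact (hc f hf g hg).mono hxf hyg

/-- Multiplication of ideals is subset multiplication. -/
instance : Mul (DistributiveCompletion S) where
  mul A B := ⟨{z | ∃ x ∈ A.carrier, ∃ y ∈ B.carrier, z = x * y}, by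
    obtain ⟨F, hF, hF0, hFc, hFd⟩ := A.exists_generators
    obtain ⟨G, hG, hG0, hGc, hGd⟩ := B.exists_generators
    refine ⟨Set.image2 (· * ·) F G, hF.image2 _ hG, hF0.image2 hG0, ?_, ?_⟩
    · rintro _ ⟨f, hf, g, hg, rfl⟩ _ ⟨f', hf', g', hg', rfl⟩
      exact (hFc f hf f' hf').mul (hGc g hg g' hg')
    · ext z
      rw [hFd, hGd]
      constructor
      · rintro ⟨x, ⟨f, hf, hxf⟩, y, ⟨g, hg, hyg⟩, rfl⟩
        exact ⟨f * g, ⟨f, hf, g, hg, rfl⟩, mul_le_mul'' hxf hyg⟩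
      · rintro ⟨_, ⟨f, hf, g, hg, rfl⟩, e, he, rfl⟩
        exact ⟨f, ⟨f, hf, le_rfl⟩, g * e, ⟨g, hg, mul_idem_le g he⟩, mul_assoc _ _ _⟩⟩

instance : Inv (DistributiveCompletion S) where
  inv A := ⟨{z | z⁻¹ ∈ A.carrier}, by
    obtain ⟨F, hF, hF0, hFc, hFd⟩ := A.exists_generators
    refine ⟨(fun x => x⁻¹) '' F, hF.image _, hF0.image _, ?_, ?_⟩
    · rintro _ ⟨f, hf, rfl⟩ _ ⟨g, hg, rfl⟩
      exact (hFc f hf g hg).inv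
    · ext z
      rw [hFd]
      constructor
      · rintro ⟨f, hf, h⟩
        exact ⟨f⁻¹, ⟨f, hf, rfl⟩, by simpa only [inv_inv'] using inv_le_inv'' h⟩
      · rintro ⟨_, ⟨f, hf, rfl⟩, h⟩
        exact ⟨f, hf, by simpa only [inv_inv'] using inv_le_inv'' h⟩⟩

/-- The zero of `D(S)` is `0^↓ = {0}`. -/
instance : Zero (DistributiveCompletion S) where
  zero := ⟨{0}, {0}, Set.finite_singleton 0, Set.singleton_nonempty 0, by
    rintro _ rfl _ rfl
    exact compatible_of_le le_rfl le_rfl, by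
    ext z
    constructor
    · rintro rfl
      exact ⟨0, rfl, le_rfl⟩
    · rintro ⟨_, rfl, h⟩
      exact le_antisymm h (zero_le' z)⟩

theorem mem_mul {A B : DistributiveCompletion S} {z : S} :
    z ∈ (A * B).carrier ↔ ∃ x ∈ A.carrier, ∃ y ∈ B.carrier, z = x * y := Iff.rfl

theorem mem_inv {A : DistributiveCompletion S} {z : S} :
    z ∈ (A⁻¹).carrier ↔ z⁻¹ ∈ A.carrier := Iff.rfl

theorem mem_zero {z : S} : z ∈ (0 : DistributiveCompletion S).carrier ↔ z = 0 := Iff.rfl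

theorem nonempty (A : DistributiveCompletion S) : ∃ x, x ∈ A.carrier := by
  obtain ⟨F, -, ⟨f, hf⟩, -, hFd⟩ := A.exists_generators
  exact ⟨f, by rw [hFd]; exact ⟨f, hf, le_rfl⟩⟩

instance : SemigroupWithZero (DistributiveCompletion S) where
  mul_assoc A B C := by
    ext z
    constructor
    · rintro ⟨_, ⟨a, ha, b, hb, rfl⟩, c, hc, rfl⟩
      exact ⟨a, ha, b * c, ⟨b, hb, c, hc, rfl⟩, mul_assoc _ _ _⟩
    · rintro ⟨a, ha, _, ⟨b, hb, c, hc, rfl⟩, rfl⟩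
      exact ⟨a * b, ⟨a, ha, b, hb, rfl⟩, c, hc, (mul_assoc _ _ _).symm⟩
  zero_mul A := by
    ext z
    constructor
    · rintro ⟨_, rfl, y, _, rfl⟩
      exact zero_mul y
    · rintro rfl
      obtain ⟨x, hx⟩ := A.nonempty
      exact ⟨0, rfl, x, hx, (zero_mul x).symm⟩
  mul_zero A := by
    ext z
    constructor
    · rintro ⟨y, _, _, rfl, rfl⟩
      exact mul_zero y
    · rintro rfl
      obtain ⟨x, hx⟩ := A.nonempty
      exact ⟨x, hx, 0, rfl, (mul_zero x).symm⟩

theorem inv_inv_eq (A : DistributiveCompletion S) : A⁻¹⁻¹ = A := by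
  ext z
  rw [mem_inv, mem_inv, inv_inv']

theorem mul_inv_mul_eq (A : DistributiveCompletion S) : A * A⁻¹ * A = A := by
  ext z
  constructor
  · rintro ⟨_, ⟨a, ha, b, hb, rfl⟩, c, hc, rfl⟩
    have h : IsIdempotentElem (a * b) := by simpa only [inv_inv'] using (A.compat ha hb).2
    exact A.lower (idem_mul_le c h) hc
  · intro hz
    exact ⟨z * z⁻¹, ⟨z, hz, z⁻¹, by rwa [mem_inv, inv_inv'], rfl⟩, z, hz,
      (InverseSemigroupWithZero.mul_inv_mul z).symm⟩

theorem idem_of_mem_mul_inv {A : DistributiveCompletion S} {z : S}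
    (hz : z ∈ (A * A⁻¹).carrier) : z * z = z := by
  obtain ⟨a, ha, b, hb, rfl⟩ := hz
  simpa only [inv_inv', IsIdempotentElem] using (A.compat ha hb).2

instance : InverseSemigroupWithZero (DistributiveCompletion S) where
  mul_inv_mul := mul_inv_mul_eq
  inv_mul_inv A := by
    have := mul_inv_mul_eq A⁻¹
    rwa [inv_inv_eq] at this
  inv_unique := unique_of_proj mul_inv_mul_eq inv_inv_eq (fun A B => by
    ext z
    constructor
    · rintro ⟨x, hx, y, hy, rfl⟩
      exact ⟨y, hy, x, hx, idem_comm (idem_of_mem_mul_inv hx) (idem_of_mem_mul_inv hy)⟩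
    · rintro ⟨x, hx, y, hy, rfl⟩
      exact ⟨y, hy, x, hx, idem_comm (idem_of_mem_mul_inv hx) (idem_of_mem_mul_inv hy)⟩)

theorem idem_of_mem_idem {E : DistributiveCompletion S} (hE : E * E = E) {z : S}
    (hz : z ∈ E.carrier) : z * z = z := by
  have h : E * E⁻¹ = E := by rw [idem_inv hE, hE]
  rw [← h] at hz
  exact idem_of_mem_mul_inv hz

/-- The natural partial order of `D(S)` is inclusion. -/
theorem le_iff {A B : DistributiveCompletion S} : A ≤ B ↔ A.carrier ⊆ B.carrier := by
  constructor
  · rintro ⟨E, hE, rfl⟩ _ ⟨b, hb, e, he, rfl⟩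
    exact B.lower (mul_idem_le b (idem_of_mem_idem hE he)) hb
  · intro h
    refine ⟨A⁻¹ * A, inv_mul_self_idem A, ?_⟩
    rw [← mul_assoc]
    ext z
    constructor
    · intro hz
      exact ⟨z * z⁻¹, ⟨z, h hz, z⁻¹, by rwa [mem_inv, inv_inv'], rfl⟩, z, hz,
        (InverseSemigroupWithZero.mul_inv_mul z).symm⟩
    · rintro ⟨_, ⟨b, hb, a, ha, rfl⟩, a', ha', rfl⟩
      have hk : IsIdempotentElem (b * a) := by
        simpa only [inv_inv'] using (B.compat hb (h ha)).2
      exact A.lower (idem_mul_le a' hk) ha'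

theorem exists_union {A B : DistributiveCompletion S} (h : Compatible A B) :
    ∃ C : DistributiveCompletion S, C.carrier = A.carrier ∪ B.carrier := by
  obtain ⟨F, hF, hF0, hFc, hFd⟩ := A.exists_generators
  obtain ⟨G, hG, hG0, hGc, hGd⟩ := B.exists_generators
  have hAB : ∀ a ∈ A.carrier, ∀ b ∈ B.carrier, Compatible a b := fun a ha b hb =>
    ⟨idem_of_mem_idem h.1 ⟨a⁻¹, by rwa [mem_inv, inv_inv'], b, hb, rfl⟩,
      idem_of_mem_idem h.2 ⟨a, ha, b⁻¹, by rwa [mem_inv, inv_inv'], rfl⟩⟩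
  have hBA : ∀ b ∈ B.carrier, ∀ a ∈ A.carrier, Compatible b a := fun b hb a ha => by
    have k := hAB a ha b hb
    constructor
    · have h1 := idem_inv k.1
      rw [mul_inv_rev', inv_inv'] at h1
      rw [h1]; exact k.1
    · have h1 := idem_inv k.2
      rw [mul_inv_rev', inv_inv'] at h1
      rw [h1]; exact k.2
  have hFA : ∀ f ∈ F, f ∈ A.carrier := fun f hf => by rw [hFd]; exact ⟨f, hf, le_rfl⟩
  have hGB : ∀ f ∈ G, f ∈ B.carrier := fun f hf => by rw [hGd]; exact ⟨f, hf, le_rfl⟩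
  refine ⟨⟨A.carrier ∪ B.carrier, F ∪ G, hF.union hG, hF0.mono Set.subset_union_left, ?_, ?_⟩, rfl⟩
  · rintro a (ha | ha) b (hb | hb)
    · exact hFc a ha b hb
    · exact hAB a (hFA a ha) b (hGB b hb)
    · exact hBA a (hGB a ha) b (hFA b hb)
    · exact hGc a ha b hb
  · rw [hFd, hGd]
    ext z
    constructor
    · rintro (⟨x, hx, h⟩ | ⟨x, hx, h⟩)
      · exact ⟨x, Or.inl hx, h⟩
      · exact ⟨x, Or.inr hx, h⟩
    · rintro ⟨x, hx | hx, h⟩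
      · exact Or.inl ⟨x, hx, h⟩
      · exact Or.inr ⟨x, hx, h⟩

theorem isLUB_of_union {A B C : DistributiveCompletion S}
    (h : C.carrier = A.carrier ∪ B.carrier) : IsLUB {A, B} C := by
  constructor
  · rintro X (rfl | rfl)
    · exact le_iff.2 (h ▸ Set.subset_union_left)
    · exact le_iff.2 (h ▸ Set.subset_union_right)
  · intro X hX
    have h1 := le_iff.1 (hX (Set.mem_insert A {B}))
    have h2 := le_iff.1 (hX (Set.mem_insert_of_mem A (Set.mem_singleton B)))
    exact le_iff.2 (h ▸ Set.union_subset h1 h2)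

theorem union_of_isLUB {A B C : DistributiveCompletion S} (hc : Compatible A B)
    (h : IsLUB {A, B} C) : C.carrier = A.carrier ∪ B.carrier := by
  obtain ⟨C', hC'⟩ := exists_union hc
  rw [h.unique (isLUB_of_union hC'), hC']

instance : DistributiveInverseSemigroup (DistributiveCompletion S) where
  exists_join A B h := (exists_union h).imp fun _ => isLUB_of_union
  mul_join A B C X hc h := by
    have hu := union_of_isLUB hc h
    apply isLUB_of_union
    ext z
    constructor
    · rintro ⟨x, hx, c, hC, rfl⟩
      rw [hu] at hC
      exact hC.imp (fun hA => ⟨x, hx, c, hA, rfl⟩) (fun hB => ⟨x, hx, c, hB, rfl⟩)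
    · rintro (⟨x, hx, c, hC, rfl⟩ | ⟨x, hx, c, hC, rfl⟩)
      · exact ⟨x, hx, c, by rw [hu]; exact Or.inl hC, rfl⟩
      · exact ⟨x, hx, c, by rw [hu]; exact Or.inr hC, rfl⟩
  join_mul A B C X hc h := by
    have hu := union_of_isLUB hc h
    apply isLUB_of_union
    ext z
    constructor
    · rintro ⟨c, hC, x, hx, rfl⟩
      rw [hu] at hC
      exact hC.imp (fun hA => ⟨c, hA, x, hx, rfl⟩) (fun hB => ⟨c, hB, x, hx, rfl⟩)
    · rintro (⟨c, hC, x, hx, rfl⟩ | ⟨c, hC, x, hx, rfl⟩)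
      · exact ⟨c, by rw [hu]; exact Or.inl hC, x, hx, rfl⟩
      · exact ⟨c, by rw [hu]; exact Or.inr hC, x, hx, rfl⟩

end DistributiveCompletion

/-! ### The groupoid of prime filters -/

/-- `A` is a prime filter of the distributive inverse semigroup `T`. -/
structure IsPrimeFilter {T : Type*} [DistributiveInverseSemigroup T] (A : Set T) : Prop where
  nonempty : A.Nonempty
  upper : ∀ x ∈ A, ∀ y, x ≤ y → y ∈ A
  directed : ∀ x ∈ A, ∀ y ∈ A, ∃ z ∈ A, z ≤ x ∧ z ≤ y
  zero_notMem : (0 : T) ∉ A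
  prime : ∀ a b c : T, IsLUB {a, b} c → c ∈ A → a ∈ A ∨ b ∈ A

/-- The set `G(T)` of prime filters of `T`. -/
@[ext] structure PrimeFilter (T : Type*) [DistributiveInverseSemigroup T] where
  carrier : Set T
  isPrime : IsPrimeFilter carrier

namespace PrimeFilter

variable {T : Type*} [DistributiveInverseSemigroup T]

theorem isPrime_translate {A : Set T} (hA : IsPrimeFilter A) (a : T) (hne : ∃ x, a * x ∈ A) :
    IsPrimeFilter {x | a * x ∈ A} where
  nonempty := hne
  upper x hx y h := hA.upper _ hx _ (mul_le_mul'' le_rfl h)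
  directed x hx y hy := by
    obtain ⟨w, hw, h1, h2⟩ := hA.directed _ hx _ hy
    refine ⟨a⁻¹ * w, ?_, ?_, ?_⟩
    · show a * (a⁻¹ * w) ∈ A
      rwa [mul_inv_mul_of_le h1]
    · exact (mul_le_mul'' le_rfl h1).trans (inv_mul_mul_le a x)
    · exact (mul_le_mul'' le_rfl h2).trans (inv_mul_mul_le a y)
  zero_notMem h := hA.zero_notMem (by simpa only [Set.mem_ofPred_eq, mul_zero] using h)
  prime x y c h hc := by
    have hxy : Compatible x y := compatible_of_le (h.1 (Set.mem_insert x {y}))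
      (h.1 (Set.mem_insert_of_mem x (Set.mem_singleton y)))
    exact hA.prime _ _ _ (DistributiveInverseSemigroup.mul_join x y c a hxy h) hc

theorem isPrime_inv {A : Set T} (hA : IsPrimeFilter A) : IsPrimeFilter {x | x⁻¹ ∈ A} where
  nonempty := by
    obtain ⟨x, hx⟩ := hA.nonempty
    exact ⟨x⁻¹, by rwa [Set.mem_ofPred_eq, inv_inv']⟩
  upper x hx y h := hA.upper _ hx _ (inv_le_inv'' h)
  directed x hx y hy := by
    obtain ⟨w, hw, h1, h2⟩ := hA.directed _ hx _ hy
    refine ⟨w⁻¹, by rwa [Set.mem_ofPred_eq, inv_inv'], ?_, ?_⟩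
    · simpa only [inv_inv'] using inv_le_inv'' h1
    · simpa only [inv_inv'] using inv_le_inv'' h2
  zero_notMem h := hA.zero_notMem (by simpa only [Set.mem_ofPred_eq, zero_inv'] using h)
  prime x y c h hc := by
    refine hA.prime x⁻¹ y⁻¹ c⁻¹ ⟨?_, ?_⟩ hc
    · rintro _ (rfl | rfl)
      · exact inv_le_inv'' (h.1 (Set.mem_insert x {y}))
      · exact inv_le_inv'' (h.1 (Set.mem_insert_of_mem x (Set.mem_singleton y)))
    · intro u hu
      have h1 := inv_le_inv'' (hu (Set.mem_insert x⁻¹ {y⁻¹}))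
      have h2 := inv_le_inv'' (hu (Set.mem_insert_of_mem x⁻¹ (Set.mem_singleton y⁻¹)))
      rw [inv_inv'] at h1 h2
      have h3 : c ≤ u⁻¹ := h.2 (by rintro _ (rfl | rfl) <;> assumption)
      simpa only [inv_inv'] using inv_le_inv'' h3

/-- The inverse filter `A⁻¹`. -/
instance : Inv (PrimeFilter T) where
  inv A := ⟨{x | x⁻¹ ∈ A.carrier}, isPrime_inv A.isPrime⟩

theorem mem_inv {A : PrimeFilter T} {x : T} : x ∈ (A⁻¹).carrier ↔ x⁻¹ ∈ A.carrier := Iff.rfl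

theorem inv_mem_inv {A : PrimeFilter T} {x : T} (h : x ∈ A.carrier) : x⁻¹ ∈ (A⁻¹).carrier := by
  rwa [mem_inv, inv_inv']

theorem inv_inv_eq (A : PrimeFilter T) : A⁻¹⁻¹ = A := by
  ext x
  rw [mem_inv, mem_inv, inv_inv']

theorem up (A : PrimeFilter T) {x y : T} (hx : x ∈ A.carrier) (h : x ≤ y) : y ∈ A.carrier :=
  A.isPrime.upper x hx y h

theorem triple (A : PrimeFilter T) {x y z : T} (hx : x ∈ A.carrier) (hy : y ∈ A.carrier)
    (hz : z ∈ A.carrier) : x * y⁻¹ * z ∈ A.carrier := by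
  obtain ⟨u, hu, h1, h2⟩ := A.isPrime.directed x hx y hy
  obtain ⟨w, hw, h3, h4⟩ := A.isPrime.directed u hu z hz
  refine A.up hw ?_
  calc w = w * w⁻¹ * w := (InverseSemigroupWithZero.mul_inv_mul w).symm
    _ ≤ _ := mul_le_mul'' (mul_le_mul'' (h3.trans h1) (inv_le_inv'' (h3.trans h2))) h4

theorem mem_domain_iff {A : PrimeFilter T} {a x : T} (ha : a ∈ A.carrier) :
    x ∈ upSet {z | ∃ b ∈ A.carrier, ∃ c ∈ A.carrier, z = b⁻¹ * c} ↔ a * x ∈ A.carrier := by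
  constructor
  · rintro ⟨_, ⟨b, hb, c, hc, rfl⟩, h⟩
    refine A.up (A.triple ha hb hc) ?_
    rw [mul_assoc]
    exact mul_le_mul'' le_rfl h
  · intro h
    exact ⟨a⁻¹ * (a * x), ⟨a, ha, a * x, h, rfl⟩, inv_mul_mul_le a x⟩

/-- The domain `d(A) = (A⁻¹A)^↑`. -/
def domain (A : PrimeFilter T) : PrimeFilter T where
  carrier := upSet {z | ∃ b ∈ A.carrier, ∃ c ∈ A.carrier, z = b⁻¹ * c}
  isPrime := by
    obtain ⟨a, ha⟩ := A.isPrime.nonempty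
    have h : upSet {z | ∃ b ∈ A.carrier, ∃ c ∈ A.carrier, z = b⁻¹ * c} =
        {x | a * x ∈ A.carrier} := Set.ext fun x => mem_domain_iff ha
    rw [h]
    exact isPrime_translate A.isPrime a
      ⟨a⁻¹ * a, by rw [← mul_assoc, InverseSemigroupWithZero.mul_inv_mul]; exact ha⟩

theorem range_aux (A : PrimeFilter T) :
    upSet {z | ∃ b ∈ A.carrier, ∃ c ∈ A.carrier, z = b * c⁻¹} = (domain A⁻¹).carrier := by
  ext x
  constructor
  · rintro ⟨_, ⟨b, hb, c, hc, rfl⟩, h⟩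
    exact ⟨b * c⁻¹, ⟨b⁻¹, inv_mem_inv hb, c⁻¹, inv_mem_inv hc, by rw [inv_inv']⟩, h⟩
  · rintro ⟨_, ⟨b, hb, c, hc, rfl⟩, h⟩
    exact ⟨b⁻¹ * c, ⟨b⁻¹, hb, c⁻¹, hc, by rw [inv_inv']⟩, h⟩

/-- The range `r(A) = (AA⁻¹)^↑`. -/
def range (A : PrimeFilter T) : PrimeFilter T where
  carrier := upSet {z | ∃ b ∈ A.carrier, ∃ c ∈ A.carrier, z = b * c⁻¹}
  isPrime := by
    rw [range_aux]
    exact (domain A⁻¹).isPrime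

theorem domain_inv (A : PrimeFilter T) : domain A⁻¹ = range A :=
  PrimeFilter.ext (range_aux A).symm

theorem range_inv (A : PrimeFilter T) : range A⁻¹ = domain A := by
  rw [← domain_inv, inv_inv_eq]

theorem mem_domain {A : PrimeFilter T} {a x : T} (ha : a ∈ A.carrier) :
    x ∈ (domain A).carrier ↔ a * x ∈ A.carrier := mem_domain_iff ha

theorem inv_mul_mem_domain {A : PrimeFilter T} {a x : T} (ha : a ∈ A.carrier)
    (hx : x ∈ A.carrier) : a⁻¹ * x ∈ (domain A).carrier :=
  ⟨_, ⟨a, ha, x, hx, rfl⟩, le_rfl⟩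

theorem mem_iff {A : PrimeFilter T} {a x : T} (ha : a ∈ A.carrier) :
    x ∈ A.carrier ↔ a⁻¹ * x ∈ (domain A).carrier := by
  constructor
  · exact inv_mul_mem_domain ha
  · intro h
    exact A.up ((mem_domain ha).1 h) (mul_inv_mul_le a x)

theorem eq_of_domain {A B : PrimeFilter T} {a : T} (ha : a ∈ A.carrier) (hb : a ∈ B.carrier)
    (h : domain A = domain B) : A = B := by
  ext x
  rw [mem_iff ha, mem_iff hb, h]

theorem eq_of_range {A B : PrimeFilter T} {a : T} (ha : a ∈ A.carrier) (hb : a ∈ B.carrier)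
    (h : range A = range B) : A = B := by
  rw [← inv_inv_eq A, ← inv_inv_eq B,
    eq_of_domain (inv_mem_inv ha) (inv_mem_inv hb) (by rw [domain_inv, domain_inv, h])]

theorem mem_range {A : PrimeFilter T} {a x : T} (ha : a ∈ A.carrier) :
    x ∈ (range A).carrier ↔ a⁻¹ * x ∈ (A⁻¹).carrier := by
  rw [← domain_inv, mem_domain (inv_mem_inv ha)]

/-- `r(B)` acts on `B` from the left. -/
theorem range_mul_mem {B : PrimeFilter T} {p b : T} (hp : p ∈ (range B).carrier)
    (hb : b ∈ B.carrier) : p * b ∈ B.carrier := by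
  obtain ⟨_, ⟨x, hx, y, hy, rfl⟩, h⟩ := hp
  exact B.up (B.triple hx hy hb) (mul_le_mul'' h le_rfl)

theorem mem_comp_iff {A B : PrimeFilter T} (h : domain A = range B) {a x : T}
    (ha : a ∈ A.carrier) :
    x ∈ upSet {z | ∃ b ∈ A.carrier, ∃ c ∈ B.carrier, z = b * c} ↔ a⁻¹ * x ∈ B.carrier := by
  constructor
  · rintro ⟨_, ⟨b, hb, c, hc, rfl⟩, hx⟩
    have h1 : a⁻¹ * b ∈ (range B).carrier := h ▸ inv_mul_mem_domain ha hb
    refine B.up (range_mul_mem h1 hc) ?_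
    rw [mul_assoc]
    exact mul_le_mul'' le_rfl hx
  · intro hx
    exact ⟨a * (a⁻¹ * x), ⟨a, ha, a⁻¹ * x, hx, rfl⟩, mul_inv_mul_le a x⟩

/-- The product `A · B = (AB)^↑` in the groupoid `G(T)`, defined when `d(A) = r(B)`. -/
def comp (A B : PrimeFilter T) (h : domain A = range B) : PrimeFilter T where
  carrier := upSet {z | ∃ b ∈ A.carrier, ∃ c ∈ B.carrier, z = b * c}
  isPrime := by
    obtain ⟨a, ha⟩ := A.isPrime.nonempty
    obtain ⟨b, hb⟩ := B.isPrime.nonempty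
    have e : upSet {z | ∃ b ∈ A.carrier, ∃ c ∈ B.carrier, z = b * c} =
        {x | a⁻¹ * x ∈ B.carrier} := Set.ext fun x => mem_comp_iff h ha
    rw [e]
    exact isPrime_translate B.isPrime a⁻¹ ⟨a * b, (mem_comp_iff h ha).1
      ⟨a * b, ⟨a, ha, b, hb, rfl⟩, le_rfl⟩⟩

theorem mem_comp {A B : PrimeFilter T} (h : domain A = range B) {a x : T}
    (ha : a ∈ A.carrier) : x ∈ (comp A B h).carrier ↔ a⁻¹ * x ∈ B.carrier :=
  mem_comp_iff h ha

theorem mul_mem_comp {A B : PrimeFilter T} (h : domain A = range B) {a b : T}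
    (ha : a ∈ A.carrier) (hb : b ∈ B.carrier) : a * b ∈ (comp A B h).carrier :=
  ⟨_, ⟨a, ha, b, hb, rfl⟩, le_rfl⟩

theorem domain_comp {A B : PrimeFilter T} (h : domain A = range B) :
    domain (comp A B h) = domain B := by
  obtain ⟨a, ha⟩ := A.isPrime.nonempty
  obtain ⟨b, hb⟩ := B.isPrime.nonempty
  have hab : a⁻¹ * (a * b) ∈ B.carrier := (mem_comp h ha).1 (mul_mem_comp h ha hb)
  ext x
  rw [mem_domain (mul_mem_comp h ha hb), mem_comp h ha, mem_domain hab]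
  simp only [mul_assoc]

theorem inv_comp {A B : PrimeFilter T} (h : domain A = range B) :
    (comp A B h)⁻¹ = comp B⁻¹ A⁻¹ (by rw [domain_inv, range_inv, h]) := by
  ext x
  constructor
  · rintro ⟨_, ⟨b, hb, c, hc, rfl⟩, hx⟩
    refine ⟨c⁻¹ * b⁻¹, ⟨c⁻¹, inv_mem_inv hc, b⁻¹, inv_mem_inv hb, rfl⟩, ?_⟩
    have := inv_le_inv'' hx
    rwa [mul_inv_rev', inv_inv'] at this
  · rintro ⟨_, ⟨b, hb, c, hc, rfl⟩, hx⟩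
    refine ⟨c⁻¹ * b⁻¹, ⟨c⁻¹, hc, b⁻¹, hb, rfl⟩, ?_⟩
    have := inv_le_inv'' hx
    rwa [mul_inv_rev'] at this

theorem range_comp {A B : PrimeFilter T} (h : domain A = range B) :
    range (comp A B h) = range A := by
  rw [← domain_inv, inv_comp, domain_comp, domain_inv]

theorem comp_assoc {A B C : PrimeFilter T} (h : domain A = range B) (k : domain B = range C) :
    comp (comp A B h) C ((domain_comp h).trans k) =
      comp A (comp B C k) (h.trans (range_comp k).symm) := by
  obtain ⟨a, ha⟩ := A.isPrime.nonempty
  obtain ⟨b, hb⟩ := B.isPrime.nonempty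
  ext x
  rw [mem_comp _ (mul_mem_comp h ha hb), mem_comp _ ha, mem_comp k hb, mul_inv_rev', mul_assoc]

theorem domain_domain (A : PrimeFilter T) : domain (domain A) = domain A := by
  obtain ⟨a, ha⟩ := A.isPrime.nonempty
  ext x
  have e : a * (a⁻¹ * a * x) = a * x := by
    rw [← mul_assoc, ← mul_assoc, InverseSemigroupWithZero.mul_inv_mul]
  rw [mem_domain (inv_mul_mem_domain ha ha), mem_domain ha, mem_domain ha, e]

theorem comp_inv_self (A : PrimeFilter T) :
    comp A A⁻¹ (range_inv A).symm = range A := by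
  ext x
  constructor
  · rintro ⟨_, ⟨b, hb, c, hc, rfl⟩, hx⟩
    exact ⟨b * c, ⟨b, hb, c⁻¹, hc, by rw [inv_inv']⟩, hx⟩
  · rintro ⟨_, ⟨b, hb, c, hc, rfl⟩, hx⟩
    exact ⟨b * c⁻¹, ⟨b, hb, c⁻¹, inv_mem_inv hc, rfl⟩, hx⟩

theorem domain_range (A : PrimeFilter T) : domain (range A) = range A := by
  rw [← domain_inv, domain_domain]

theorem inv_domain (A : PrimeFilter T) : (domain A)⁻¹ = domain A := by
  ext x
  constructor
  · rintro ⟨_, ⟨b, hb, c, hc, rfl⟩, hx⟩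
    refine ⟨c⁻¹ * b, ⟨c, hc, b, hb, rfl⟩, ?_⟩
    have := inv_le_inv'' hx
    rwa [mul_inv_rev', inv_inv', inv_inv'] at this
  · rintro ⟨_, ⟨b, hb, c, hc, rfl⟩, hx⟩
    refine ⟨c⁻¹ * b, ⟨c, hc, b, hb, rfl⟩, ?_⟩
    have := inv_le_inv'' hx
    rwa [mul_inv_rev', inv_inv'] at this

theorem range_domain (A : PrimeFilter T) : range (domain A) = domain A := by
  rw [← domain_inv, inv_domain, domain_domain]

theorem range_range (A : PrimeFilter T) : range (range A) = range A := by
  rw [← domain_inv A, range_domain]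

theorem range_comp_self (A : PrimeFilter T) : comp (range A) A (domain_range A) = A := by
  ext x
  constructor
  · rintro ⟨_, ⟨b, hb, c, hc, rfl⟩, hx⟩
    exact A.up (range_mul_mem hb hc) hx
  · intro hx
    exact ⟨x * x⁻¹ * x, ⟨x * x⁻¹, ⟨_, ⟨x, hx, x, hx, rfl⟩, le_rfl⟩, x, hx, rfl⟩,
      (InverseSemigroupWithZero.mul_inv_mul x).le⟩

end PrimeFilter

/-! ### The inverse semigroup of partial bisections -/

/-- The partial bisections of the groupoid `G(T)`: the elements of `L(G(T))`. -/
@[ext] structure PartialBisection (T : Type*) [DistributiveInverseSemigroup T] where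
  carrier : Set (PrimeFilter T)
  domain_inj : ∀ A ∈ carrier, ∀ B ∈ carrier, A.domain = B.domain → A = B
  range_inj : ∀ A ∈ carrier, ∀ B ∈ carrier, A.range = B.range → A = B

namespace PartialBisection

variable {T : Type*} [DistributiveInverseSemigroup T]

/-- Subset multiplication: all products `A · B` that are defined. -/
instance : Mul (PartialBisection T) where
  mul X Y :=
    { carrier := {C | ∃ A ∈ X.carrier, ∃ B ∈ Y.carrier, ∃ h : A.domain = B.range,
        C = A.comp B h}
      domain_inj := by
        rintro _ ⟨A, hA, B, hB, h, rfl⟩ _ ⟨A', hA', B', hB', h', rfl⟩ e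
        rw [PrimeFilter.domain_comp, PrimeFilter.domain_comp] at e
        obtain rfl := Y.domain_inj _ hB _ hB' e
        obtain rfl := X.domain_inj _ hA _ hA' (h.trans h'.symm)
        rfl
      range_inj := by
        rintro _ ⟨A, hA, B, hB, h, rfl⟩ _ ⟨A', hA', B', hB', h', rfl⟩ e
        rw [PrimeFilter.range_comp, PrimeFilter.range_comp] at e
        obtain rfl := X.range_inj _ hA _ hA' e
        obtain rfl := Y.range_inj _ hB _ hB' (h.symm.trans h')
        rfl }

instance : Inv (PartialBisection T) where
  inv X :=
    { carrier := {A | A⁻¹ ∈ X.carrier}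
      domain_inj := by
        intro A hA B hB e
        have := X.range_inj _ hA _ hB (by rw [PrimeFilter.range_inv, PrimeFilter.range_inv, e])
        rw [← PrimeFilter.inv_inv_eq A, this, PrimeFilter.inv_inv_eq]
      range_inj := by
        intro A hA B hB e
        have := X.domain_inj _ hA _ hB (by rw [PrimeFilter.domain_inv, PrimeFilter.domain_inv, e])
        rw [← PrimeFilter.inv_inv_eq A, this, PrimeFilter.inv_inv_eq] }

instance : Zero (PartialBisection T) where
  zero := ⟨∅, fun _ h => h.elim, fun _ h => h.elim⟩

theorem mem_mul {X Y : PartialBisection T} {C : PrimeFilter T} :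
    C ∈ (X * Y).carrier ↔ ∃ A ∈ X.carrier, ∃ B ∈ Y.carrier, ∃ h : A.domain = B.range,
      C = A.comp B h := Iff.rfl

theorem mem_inv {X : PartialBisection T} {A : PrimeFilter T} :
    A ∈ (X⁻¹).carrier ↔ A⁻¹ ∈ X.carrier := Iff.rfl

theorem notMem_zero {A : PrimeFilter T} : A ∉ (0 : PartialBisection T).carrier := fun h => h

instance : SemigroupWithZero (PartialBisection T) where
  mul_assoc X Y Z := by
    ext D
    constructor
    · rintro ⟨_, ⟨A, hA, B, hB, h, rfl⟩, C, hC, k, rfl⟩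
      have k' := (PrimeFilter.domain_comp h).symm.trans k
      exact ⟨A, hA, _, ⟨B, hB, C, hC, k', rfl⟩, _, PrimeFilter.comp_assoc h k'⟩
    · rintro ⟨A, hA, _, ⟨B, hB, C, hC, k, rfl⟩, h, rfl⟩
      have h' := h.trans (PrimeFilter.range_comp k)
      exact ⟨_, ⟨A, hA, B, hB, h', rfl⟩, C, hC, _, (PrimeFilter.comp_assoc h' k).symm⟩
  zero_mul X := by
    ext C
    exact ⟨fun ⟨A, hA, _⟩ => (notMem_zero hA).elim, fun h => (notMem_zero h).elim⟩
  mul_zero X := by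
    ext C
    exact ⟨fun ⟨_, _, _, hB, _⟩ => (notMem_zero hB).elim, fun h => (notMem_zero h).elim⟩

theorem inv_inv_eq (X : PartialBisection T) : X⁻¹⁻¹ = X := by
  ext A
  rw [mem_inv, mem_inv, PrimeFilter.inv_inv_eq]

theorem mem_mul_inv {X : PartialBisection T} {C : PrimeFilter T} :
    C ∈ (X * X⁻¹).carrier ↔ ∃ A ∈ X.carrier, C = A.range := by
  constructor
  · rintro ⟨A, hA, B, hB, h, rfl⟩
    have e : A = B⁻¹ := X.domain_inj _ hA _ hB (by rw [h, PrimeFilter.domain_inv])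
    have e' : B = A⁻¹ := by rw [e, PrimeFilter.inv_inv_eq]
    subst e'
    exact ⟨A, hA, PrimeFilter.comp_inv_self A⟩
  · rintro ⟨A, hA, rfl⟩
    exact ⟨A, hA, A⁻¹, by rwa [mem_inv, PrimeFilter.inv_inv_eq], (PrimeFilter.range_inv A).symm,
      (PrimeFilter.comp_inv_self A).symm⟩

theorem mul_inv_mul_eq (X : PartialBisection T) : X * X⁻¹ * X = X := by
  ext C
  constructor
  · rintro ⟨_, hAB, C, hC, k, rfl⟩
    obtain ⟨A, hA, rfl⟩ := mem_mul_inv.1 hAB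
    have e : A = C := X.range_inj _ hA _ hC (by rw [← k, PrimeFilter.domain_range])
    subst e
    rwa [PrimeFilter.range_comp_self]
  · intro hC
    exact ⟨C.range, mem_mul_inv.2 ⟨C, hC, rfl⟩, C, hC, PrimeFilter.domain_range C,
      (PrimeFilter.range_comp_self C).symm⟩

theorem mem_proj_mul {X Y : PartialBisection T} {C : PrimeFilter T} :
    C ∈ (X * X⁻¹ * (Y * Y⁻¹)).carrier ↔ C ∈ (X * X⁻¹).carrier ∧ C ∈ (Y * Y⁻¹).carrier := by
  constructor
  · rintro ⟨_, hA, _, hB, h, rfl⟩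
    obtain ⟨A, hA', rfl⟩ := mem_mul_inv.1 hA
    obtain ⟨B, hB', rfl⟩ := mem_mul_inv.1 hB
    have e : A.range = B.range := by
      rwa [PrimeFilter.domain_range, PrimeFilter.range_range] at h
    have e' : PrimeFilter.comp A.range B.range h = B.range := by
      have key : ∀ (P Q : PrimeFilter T) (w : P.domain = Q.range), P = Q.range →
          P.comp Q w = Q := by
        rintro _ Q w rfl
        exact PrimeFilter.range_comp_self Q
      exact key _ _ h (by rw [PrimeFilter.range_range, e])
    rw [e']
    exact ⟨e ▸ hA, hB⟩
  · rintro ⟨hA, hB⟩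
    obtain ⟨A, hA', rfl⟩ := mem_mul_inv.1 hA
    have key : ∀ (P Q : PrimeFilter T) (w : P.domain = Q.range), P = Q.range →
        P.comp Q w = Q := by
      rintro _ Q w rfl
      exact PrimeFilter.range_comp_self Q
    exact ⟨_, hA, _, hB, by rw [PrimeFilter.domain_range, PrimeFilter.range_range],
      (key _ _ _ (PrimeFilter.range_range A).symm).symm⟩

/-- The inverse semigroup `L(G(T))`. -/
instance : InverseSemigroupWithZero (PartialBisection T) where
  mul_inv_mul := mul_inv_mul_eq
  inv_mul_inv X := by
    have := mul_inv_mul_eq X⁻¹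
    rwa [inv_inv_eq] at this
  inv_unique := unique_of_proj mul_inv_mul_eq inv_inv_eq (fun X Y => by
    ext C
    rw [mem_proj_mul, mem_proj_mul, and_comm])

/-- The partial bisection `V_{s;t} = V_s \ V_t` of all prime filters that contain `s` and
omit `t`. -/
def basic (s t : T) : PartialBisection T where
  carrier := {A | s ∈ A.carrier ∧ t ∉ A.carrier}
  domain_inj _ hA _ hB h := PrimeFilter.eq_of_domain hA.1 hB.1 h
  range_inj _ hA _ hB h := PrimeFilter.eq_of_range hA.1 hB.1 h

theorem mem_basic {s t : T} {A : PrimeFilter T} :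
    A ∈ (basic s t).carrier ↔ s ∈ A.carrier ∧ t ∉ A.carrier := Iff.rfl

theorem basic_inv (s t : T) : (basic s t)⁻¹ = basic s⁻¹ t⁻¹ := by
  ext A
  rw [mem_inv, mem_basic, mem_basic, PrimeFilter.mem_inv, PrimeFilter.mem_inv]

theorem basic_mul {s t u v w : T} (hw : IsLUB {s * v, t * u} w) :
    basic s t * basic u v = basic (s * u) w := by
  have hw1 : s * v ≤ w := hw.1 (Set.mem_insert _ _)
  have hw2 : t * u ≤ w := hw.1 (Set.mem_insert_of_mem _ (Set.mem_singleton _))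
  ext C
  constructor
  · rintro ⟨A, ⟨hs, ht⟩, B, ⟨hu, hv⟩, h, rfl⟩
    refine ⟨PrimeFilter.mul_mem_comp h hs hu, fun hwC => ?_⟩
    rcases (A.comp B h).isPrime.prime _ _ _ hw hwC with h1 | h1
    · exact hv (B.up ((PrimeFilter.mem_comp h hs).1 h1) (inv_mul_mul_le s v))
    · rw [← PrimeFilter.inv_inv_eq (A.comp B h), PrimeFilter.mem_inv, PrimeFilter.inv_comp,
        PrimeFilter.mem_comp _ (PrimeFilter.inv_mem_inv hu), PrimeFilter.mem_inv] at h1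
      refine ht (A.up h1 ?_)
      simp only [mul_inv_rev', inv_inv', mul_assoc]
      exact mul_idem_le t (mul_inv_self_idem u)
  · rintro ⟨hsu, hwC⟩
    have hB : IsPrimeFilter {x | s * x ∈ C.carrier} :=
      PrimeFilter.isPrime_translate C.isPrime s ⟨u, hsu⟩
    obtain ⟨B, hBm⟩ : ∃ B : PrimeFilter T, ∀ x, x ∈ B.carrier ↔ s * x ∈ C.carrier :=
      ⟨⟨_, hB⟩, fun _ => Iff.rfl⟩
    have huB : u ∈ B.carrier := (hBm u).2 hsu
    have hdB : B.domain = C.domain := by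
      ext x
      rw [PrimeFilter.mem_domain huB, PrimeFilter.mem_domain hsu, hBm, mul_assoc]
    have hk : C.domain = (B⁻¹).range := by rw [PrimeFilter.range_inv, hdB]
    have hsA : s ∈ (C.comp B⁻¹ hk).carrier := by
      rw [PrimeFilter.mem_comp hk hsu, PrimeFilter.mem_inv, mul_inv_rev', inv_inv', hBm,
        ← mul_assoc, ← mul_assoc, InverseSemigroupWithZero.mul_inv_mul]
      exact hsu
    have hAB : (C.comp B⁻¹ hk).domain = B.range := by
      rw [PrimeFilter.domain_comp, PrimeFilter.domain_inv]
    refine ⟨C.comp B⁻¹ hk, ⟨hsA, fun ht => ?_⟩, B, ⟨huB, fun hv => ?_⟩, hAB, ?_⟩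
    · refine hwC (C.up ?_ hw2)
      rw [PrimeFilter.mem_comp hk hsu, PrimeFilter.mem_inv, hBm, mul_inv_rev', inv_inv'] at ht
      have h1 := C.triple hsu ht hsu
      refine C.up h1 ?_
      rw [mul_inv_rev', mul_inv_rev', inv_inv']
      have e : s * u * ((s * u)⁻¹ * t * s⁻¹) * (s * u) =
          s * u * (s * u)⁻¹ * (t * (s⁻¹ * (s * u))) := by simp only [mul_assoc]
      rw [e]
      exact (idem_mul_le _ (mul_inv_self_idem _)).trans
        (mul_le_mul'' le_rfl (inv_mul_mul_le s u))
    · exact hwC (C.up ((hBm v).1 hv) hw1)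
    · apply PrimeFilter.eq_of_domain hsu (PrimeFilter.mul_mem_comp hAB hsA huB)
      rw [PrimeFilter.domain_comp, hdB]

/-- The join of compatible finite families of elements of `V(T)`. The family may be empty, and
`V_{s;t}` with `t = s` is the empty set, the zero of `L(G(T))`. -/
def IsFiniteJoin (X : PartialBisection T) : Prop :=
  ∃ F : Set (PartialBisection T), F.Finite ∧
    (∀ Y ∈ F, ∃ s t : T, t ≤ s ∧ Y = basic s t) ∧
    (∀ Y ∈ F, ∀ Z ∈ F, Compatible Y Z) ∧
    X.carrier = ⋃ Y ∈ F, Y.carrier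

theorem IsFiniteJoin.zero : IsFiniteJoin (0 : PartialBisection T) :=
  ⟨∅, Set.finite_empty, fun _ h => h.elim, fun _ h => h.elim, by simp; rfl⟩

theorem IsFiniteJoin.inv {X : PartialBisection T} (hX : IsFiniteJoin X) : IsFiniteJoin X⁻¹ := by
  obtain ⟨F, hF, hV, hc, hX⟩ := hX
  refine ⟨(fun Y => Y⁻¹) '' F, hF.image _, ?_, ?_, ?_⟩
  · rintro _ ⟨Y, hY, rfl⟩
    obtain ⟨s, t, hst, rfl⟩ := hV Y hY
    exact ⟨s⁻¹, t⁻¹, inv_le_inv'' hst, basic_inv s t⟩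
  · rintro _ ⟨Y, hY, rfl⟩ _ ⟨Z, hZ, rfl⟩
    exact (hc Y hY Z hZ).inv
  · ext A
    rw [mem_inv, hX]
    simp [mem_inv]

theorem IsFiniteJoin.mul {X Y : PartialBisection T} (hX : IsFiniteJoin X)
    (hY : IsFiniteJoin Y) : IsFiniteJoin (X * Y) := by
  obtain ⟨F, hF, hFV, hFc, hX⟩ := hX
  obtain ⟨G, hG, hGV, hGc, hY⟩ := hY
  refine ⟨Set.image2 (· * ·) F G, hF.image2 _ hG, ?_, ?_, ?_⟩
  · rintro _ ⟨P, hP, Q, hQ, rfl⟩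
    obtain ⟨s, t, hst, rfl⟩ := hFV P hP
    obtain ⟨u, v, huv, rfl⟩ := hGV Q hQ
    have h1 : s * v ≤ s * u := mul_le_mul'' le_rfl huv
    have h2 : t * u ≤ s * u := mul_le_mul'' hst le_rfl
    obtain ⟨w, hw⟩ := DistributiveInverseSemigroup.exists_join _ _ (compatible_of_le h1 h2)
    exact ⟨s * u, w, hw.2 (by rintro _ (rfl | rfl) <;> assumption), basic_mul hw⟩
  · rintro _ ⟨P, hP, Q, hQ, rfl⟩ _ ⟨P', hP', Q', hQ', rfl⟩
    exact (hFc P hP P' hP').mul (hGc Q hQ Q' hQ')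
  · ext C
    simp only [mem_mul, hX, hY, Set.mem_iUnion, exists_prop]
    constructor
    · rintro ⟨A, ⟨P, hP, hA⟩, B, ⟨Q, hQ, hB⟩, h, rfl⟩
      exact ⟨P * Q, ⟨P, hP, Q, hQ, rfl⟩, A, hA, B, hB, h, rfl⟩
    · rintro ⟨_, ⟨P, hP, Q, hQ, rfl⟩, A, hA, B, hB, h, rfl⟩
      exact ⟨A, ⟨P, hP, hA⟩, B, ⟨Q, hQ, hB⟩, h, rfl⟩

end PartialBisection

/-! ### The Booleanization -/

/-- The Booleanization of a distributive inverse semigroup `T`: all unions in `L(G(T))` of finite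
compatible subsets of `V(T) = {V_{s;t} : t ≤ s}`. -/
@[ext] structure DistributiveBooleanization (T : Type*) [DistributiveInverseSemigroup T] where
  val : PartialBisection T
  isFiniteJoin : val.IsFiniteJoin

namespace DistributiveBooleanization

variable {T : Type*} [DistributiveInverseSemigroup T]

/-- The inverse semigroup structure inherited from `L(G(T))`. -/
instance : InverseSemigroupWithZero (DistributiveBooleanization T) where
  mul X Y := ⟨X.val * Y.val, X.isFiniteJoin.mul Y.isFiniteJoin⟩
  inv X := ⟨X.val⁻¹, X.isFiniteJoin.inv⟩
  zero := ⟨0, PartialBisection.IsFiniteJoin.zero⟩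
  mul_assoc _ _ _ := DistributiveBooleanization.ext (mul_assoc _ _ _)
  zero_mul _ := DistributiveBooleanization.ext (zero_mul _)
  mul_zero _ := DistributiveBooleanization.ext (mul_zero _)
  mul_inv_mul _ := DistributiveBooleanization.ext (InverseSemigroupWithZero.mul_inv_mul _)
  inv_mul_inv _ := DistributiveBooleanization.ext (InverseSemigroupWithZero.inv_mul_inv _)
  inv_unique _ _ h k := DistributiveBooleanization.ext (inv_unique _ _
    (congrArg val h) (congrArg val k))

end DistributiveBooleanization

/-- The Booleanization `B(S) = B(D(S))` of an inverse semigroup with zero. -/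
abbrev Booleanization (S : Type*) [InverseSemigroupWithZero S] : Type _ :=
  DistributiveBooleanization (DistributiveCompletion S)

/-! Both natural orders are inclusions: of order ideals in `D(S)`, and of sets of prime filters in
the Booleanization. The question is therefore when intersections stay finitely generated.

From `S` to `B(S)`: in a weak semilattice, two finitely generated compatible ideals meet in another
one (`exists_inter`), so `T = D(S)` has binary meets. In any distributive `T` with binary meets,
V_{s;t} ∩ V_{u;v} = V_{m;w}, where m = s ∧ u and w = (m ∧ t) ∨ (m ∧ v) (`basic_inter`).
Intersections of finite unions of such sets are again finite unions, and they are the meets of the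
Booleanization.

From `B(S)` to `S`: let M be the meet of the images of a^↓ and b^↓. By directedness of filters, M
consists of all prime filters containing both ideals (`carrier_of_isGLB`). Membership in M is tested
on the filters P_c = {A | c ∈ A} with c ≠ 0. They are prime because joins in `D(S)` are unions. Now
P_c lies in M iff c ≤ a and c ≤ b, and in V_{s;t} iff c ∈ s \ t. Since M is a finite union of sets
V_{s;t}, the nonzero common lower bounds of a and b form a finite union of differences s \ t, and
the generators of s outside t generate each difference. -/

namespace InverseSemigroupWithZero

/-- The idempotent witnessing the order can always be taken to be `s⁻¹ * s`. This turns the order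
into an equation, which transfers between an inverse semigroup and an inverse subsemigroup without
asking where a witness lives. -/
theorem le_iff_eq_mul_inv_mul {S : Type*} [InverseSemigroupWithZero S] {s t : S} :
    s ≤ t ↔ s = t * (s⁻¹ * s) := by
  refine ⟨?_, fun h => ⟨_, inv_mul_self_idem s, h⟩⟩
  rintro ⟨e, he, rfl⟩
  rw [mul_inv_rev', idem_inv he]
  calc t * e = t * t⁻¹ * t * e := by rw [mul_inv_mul]
    _ = t * (t⁻¹ * t * (e * e)) := by rw [he]; simp only [mul_assoc]
    _ = t * ((t⁻¹ * t * e) * e) := by simp only [mul_assoc]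
    _ = t * ((e * (t⁻¹ * t)) * e) := by rw [idem_comm (inv_mul_self_idem t) he]
    _ = t * (e * t⁻¹ * (t * e)) := by simp only [mul_assoc]

end InverseSemigroupWithZero

namespace PrimeFilter

variable {T : Type*} [DistributiveInverseSemigroup T]

/-- Right identity law of the groupoid. Keeping `B` separate from `A.domain` lets it apply when the
identity is presented as the domain of another filter. -/
theorem comp_eq_left {A B : PrimeFilter T} (h : A.domain = B.range) (hB : A.domain = B) :
    A.comp B h = A := by
  obtain ⟨a, ha⟩ := A.isPrime.nonempty
  ext x
  rw [mem_comp h ha, ← hB, ← mem_iff ha]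

end PrimeFilter

/-! ### Order and intersections of partial bisections. -/

namespace PartialBisection

variable {T : Type*} [DistributiveInverseSemigroup T]

theorem mem_inv_mul {X : PartialBisection T} {C : PrimeFilter T} :
    C ∈ (X⁻¹ * X).carrier ↔ ∃ A ∈ X.carrier, C = A.domain := by
  have h := mem_mul_inv (X := X⁻¹) (C := C)
  rw [inv_inv_eq] at h
  rw [h]
  constructor
  · rintro ⟨A, hA, rfl⟩
    exact ⟨A⁻¹, hA, (PrimeFilter.domain_inv A).symm⟩
  · rintro ⟨A, hA, rfl⟩
    exact ⟨A⁻¹, by rwa [mem_inv, PrimeFilter.inv_inv_eq], (PrimeFilter.range_inv A).symm⟩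

/-- The natural partial order of `L(G(T))` is inclusion. -/
theorem le_iff {X Y : PartialBisection T} : X ≤ Y ↔ X.carrier ⊆ Y.carrier := by
  rw [le_iff_eq_mul_inv_mul]
  -- `X⁻¹ * X` is a set of identities, namely the domains of members of `X`. Multiplying by it on
  -- the right alters no filter; it only selects those whose domain occurs in `X`.
  have key : ∀ (A B : PrimeFilter T) (_ : B ∈ (X⁻¹ * X).carrier) (h : A.domain = B.range),
      A.comp B h = A ∧ ∃ D ∈ X.carrier, A.domain = D.domain := by
    intro A B hB h
    obtain ⟨D, hD, rfl⟩ := mem_inv_mul.1 hB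
    have h' := h.trans (PrimeFilter.range_domain D)
    exact ⟨PrimeFilter.comp_eq_left h h', D, hD, h'⟩
  constructor
  · intro h C hC
    rw [h] at hC
    obtain ⟨A, hA, B, hB, k, rfl⟩ := hC
    rwa [(key A B hB k).1]
  · intro h
    ext C
    constructor
    · intro hC
      have k := (PrimeFilter.range_domain C).symm
      exact ⟨C, h hC, C.domain, mem_inv_mul.2 ⟨C, hC, rfl⟩, k,
        (PrimeFilter.comp_eq_left k rfl).symm⟩
    · rintro ⟨A, hA, B, hB, k, rfl⟩
      obtain ⟨e, D, hD, hAD⟩ := key A B hB k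
      -- `A` and `D` both lie in `Y` and share a domain, so they coincide.
      rw [e, Y.domain_inj A hA D (h hD) hAD]
      exact hD

/-- A filter containing two elements contains their meet, by directedness and upward closure. Hence
a prime filter containing m contains the join w of m ∧ t and m ∧ v exactly when it contains t or v.
-/
theorem basic_inter {s t u v m p q w : T} (hm : IsGLB {s, u} m) (hp : IsGLB {m, t} p)
    (hq : IsGLB {m, v} q) (hw : IsLUB {p, q} w) :
    (basic m w).carrier = (basic s t).carrier ∩ (basic u v).carrier := by
  have mem_glb : ∀ {x y z : T} (A : PrimeFilter T), IsGLB {x, y} z → x ∈ A.carrier →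
      y ∈ A.carrier → z ∈ A.carrier := by
    intro x y z A h hx hy
    obtain ⟨c, hc, h1, h2⟩ := A.isPrime.directed x hx y hy
    exact A.up hc (h.2 (by rintro _ (rfl | rfl) <;> assumption))
  ext A
  simp only [Set.mem_inter_iff, mem_basic]
  constructor
  · rintro ⟨h1, h2⟩
    exact ⟨⟨A.up h1 (hm.1 (by simp)), fun ht => h2 (A.up (mem_glb A hp h1 ht) (hw.1 (by simp)))⟩,
      A.up h1 (hm.1 (by simp)), fun hv => h2 (A.up (mem_glb A hq h1 hv) (hw.1 (by simp)))⟩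
  · rintro ⟨⟨hs, ht⟩, hu, hv⟩
    refine ⟨mem_glb A hm hs hu, fun h => ?_⟩
    rcases A.isPrime.prime _ _ _ hw h with h | h
    · exact ht (A.up h (hp.1 (by simp)))
    · exact hv (A.up h (hq.1 (by simp)))

/-- The intersection of two partial bisections. -/
def inter (X Y : PartialBisection T) : PartialBisection T where
  carrier := X.carrier ∩ Y.carrier
  domain_inj A hA B hB := X.domain_inj A hA.1 B hB.1
  range_inj A hA B hB := X.range_inj A hA.1 B hB.1

theorem IsFiniteJoin.basic {s t : T} (h : t ≤ s) : IsFiniteJoin (basic s t) :=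
  ⟨{PartialBisection.basic s t}, Set.finite_singleton _, by rintro _ rfl; exact ⟨s, t, h, rfl⟩,
    by rintro _ rfl _ rfl; exact compatible_of_le le_rfl le_rfl, by simp⟩

/-- Intersection distributes over unions, which reduces the claim to pairs of basic sets. -/
theorem IsFiniteJoin.inter (hT : IsMeetSemigroup T) {X Y : PartialBisection T}
    (hX : IsFiniteJoin X) (hY : IsFiniteJoin Y) : IsFiniteJoin (X.inter Y) := by
  obtain ⟨F, hF, hFV, hFc, hX⟩ := hX
  obtain ⟨G, hG, hGV, hGc, hY⟩ := hY
  refine ⟨Set.image2 PartialBisection.inter F G, hF.image2 _ hG, ?_, ?_, ?_⟩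
  · rintro _ ⟨P, hP, Q, hQ, rfl⟩
    obtain ⟨s, t, hst, rfl⟩ := hFV P hP
    obtain ⟨u, v, huv, rfl⟩ := hGV Q hQ
    obtain ⟨m, hm⟩ := hT s u
    obtain ⟨p, hp⟩ := hT m t
    obtain ⟨q, hq⟩ := hT m v
    -- The omitted elements are first cut down below `m`: this makes them compatible, so their join
    -- exists, and it keeps the join below `m`.
    have hpm : p ≤ m := hp.1 (by simp)
    have hqm : q ≤ m := hq.1 (by simp)
    obtain ⟨w, hw⟩ := DistributiveInverseSemigroup.exists_join _ _ (compatible_of_le hpm hqm)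
    exact ⟨m, w, hw.2 (by rintro _ (rfl | rfl) <;> assumption),
      PartialBisection.ext (basic_inter hm hp hq hw).symm⟩
  · rintro _ ⟨P, hP, Q, hQ, rfl⟩ _ ⟨P', hP', Q', hQ', rfl⟩
    -- Each intersection lies below its first factor, so compatibility within `F` suffices.
    exact (hFc P hP P' hP').mono (le_iff.2 Set.inter_subset_left) (le_iff.2 Set.inter_subset_left)
  · ext C
    simp only [PartialBisection.inter, hX, hY, Set.mem_inter_iff, Set.mem_iUnion, exists_prop]
    constructor
    · rintro ⟨⟨P, hP, hC⟩, Q, hQ, hC'⟩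
      exact ⟨_, ⟨P, hP, Q, hQ, rfl⟩, hC, hC'⟩
    · rintro ⟨_, ⟨P, hP, Q, hQ, rfl⟩, hC, hC'⟩
      exact ⟨⟨P, hP, hC⟩, Q, hQ, hC'⟩

end PartialBisection

/-! ### Meets in the Booleanization of a distributive inverse semigroup. -/

namespace DistributiveBooleanization

variable {T : Type*} [DistributiveInverseSemigroup T]

/-- The natural partial order of the Booleanization is inclusion. -/
theorem le_iff {X Y : DistributiveBooleanization T} :
    X ≤ Y ↔ X.val.carrier ⊆ Y.val.carrier := by
  -- An idempotent witness in L(G(T)) need not belong to the Booleanization; the equational form of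
  -- the order avoids the issue.
  rw [← PartialBisection.le_iff, le_iff_eq_mul_inv_mul, le_iff_eq_mul_inv_mul]
  exact DistributiveBooleanization.ext_iff

theorem isMeetSemigroup (hT : IsMeetSemigroup T) :
    IsMeetSemigroup (DistributiveBooleanization T) := by
  intro X Y
  refine ⟨⟨X.val.inter Y.val, X.isFiniteJoin.inter hT Y.isFiniteJoin⟩, ?_, fun Z hZ => ?_⟩
  · rintro _ (rfl | rfl)
    · exact le_iff.2 Set.inter_subset_left
    · exact le_iff.2 Set.inter_subset_right
  · exact le_iff.2 (Set.subset_inter (le_iff.1 (hZ (by simp))) (le_iff.1 (hZ (by simp))))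

/-- The image `V_s` of `s` in the Booleanization. -/
def of (s : T) : DistributiveBooleanization T :=
  ⟨PartialBisection.basic s 0, PartialBisection.IsFiniteJoin.basic (zero_le' s)⟩

theorem mem_of {s : T} {A : PrimeFilter T} : A ∈ (of s).val.carrier ↔ s ∈ A.carrier :=
  and_iff_left A.isPrime.zero_notMem

theorem of_mono {s t : T} (h : s ≤ t) : of s ≤ of t :=
  le_iff.2 fun A hA => mem_of.2 (A.up (mem_of.1 hA) h)

/-- `T` need not have meets here, so it is not known beforehand that the intersection belongs to the
Booleanization. It is filled from below: a prime filter containing `s` and `t` contains a common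
lower bound `c`, and V_c lies below both images, hence below `M`. -/
theorem carrier_of_isGLB {s t : T} {M : DistributiveBooleanization T}
    (hM : IsGLB {of s, of t} M) :
    M.val.carrier = {A | s ∈ A.carrier ∧ t ∈ A.carrier} := by
  ext A
  constructor
  · intro h
    exact ⟨mem_of.1 (le_iff.1 (hM.1 (by simp)) h), mem_of.1 (le_iff.1 (hM.1 (by simp)) h)⟩
  · rintro ⟨hs, ht⟩
    obtain ⟨c, hc, h1, h2⟩ := A.isPrime.directed s hs t ht
    refine le_iff.1 (hM.2 (?_ : of c ∈ _)) (mem_of.2 hc)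
    rintro _ (rfl | rfl)
    · exact of_mono h1
    · exact of_mono h2

end DistributiveBooleanization

/-! ### Principal ideals, point filters and intersections in `D(S)`. -/

namespace DistributiveCompletion

variable {S : Type*} [InverseSemigroupWithZero S]

theorem zero_mem (A : DistributiveCompletion S) : (0 : S) ∈ A.carrier := by
  obtain ⟨x, hx⟩ := A.nonempty
  exact A.lower (zero_le' x) hx

/-- The principal order ideal `a^↓`. -/
def principal (a : S) : DistributiveCompletion S :=
  ⟨downSet {a}, {a}, Set.finite_singleton a, Set.singleton_nonempty a,
    by rintro _ rfl _ rfl; exact compatible_of_le le_rfl le_rfl, rfl⟩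

theorem mem_principal {a x : S} : x ∈ (principal a).carrier ↔ x ≤ a := by
  simp [principal, downSet]

theorem principal_le {a : S} {A : DistributiveCompletion S} :
    principal a ≤ A ↔ a ∈ A.carrier := by
  rw [le_iff]
  exact ⟨fun h => h (mem_principal.2 le_rfl), fun h x hx => A.lower (mem_principal.1 hx) h⟩

/-- The prime filter of all elements of `D(S)` that contain a given nonzero `c`. -/
def principalFilter (c : S) (hc : c ≠ 0) : PrimeFilter (DistributiveCompletion S) where
  carrier := {A | c ∈ A.carrier}
  isPrime :=
    { nonempty := ⟨principal c, mem_principal.2 le_rfl⟩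
      upper := fun _ hA _ h => le_iff.1 h hA
      directed := fun _ hA _ hB =>
        ⟨principal c, mem_principal.2 le_rfl, principal_le.2 hA, principal_le.2 hB⟩
      zero_notMem := fun h => hc (mem_zero.1 h)
      prime := fun A B C h hC => by
        -- Having an upper bound makes `A` and `B` compatible, so their join is their union and
        -- primality is immediate.
        have hu := union_of_isLUB (compatible_of_le (h.1 (by simp)) (h.1 (by simp))) h
        rw [Set.mem_ofPred_eq, hu] at hC
        exact hC }

theorem mem_principalFilter {c : S} {hc : c ≠ 0} {A : DistributiveCompletion S} :
    A ∈ (principalFilter c hc).carrier ↔ c ∈ A.carrier := Iff.rfl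

/-- The intersection is the union of a^↓ ∩ b^↓ over generators a of `A` and b of `B`, and each of
these finitely many pieces is finitely generated. The new generators lie in `A`, hence are pairwise
compatible. -/
theorem exists_inter (hS : IsWeakSemilattice S) (A B : DistributiveCompletion S) :
    ∃ C : DistributiveCompletion S, C.carrier = A.carrier ∩ B.carrier := by
  obtain ⟨F, hF, -, -, hFd⟩ := A.exists_generators
  obtain ⟨G, hG, -, -, hGd⟩ := B.exists_generators
  choose H hH hHd using hS
  have hHm : ∀ a b x : S, (∃ h ∈ H a b, x ≤ h) ↔ x ≤ a ∧ x ≤ b := by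
    intro a b x
    have h := Set.ext_iff.1 (hHd a b) x
    simpa [downSet] using h.symm
  have hd : A.carrier ∩ B.carrier = downSet (⋃ a ∈ F, ⋃ b ∈ G, H a b) := by
    ext x
    constructor
    · rintro ⟨hA, hB⟩
      rw [hFd] at hA
      rw [hGd] at hB
      obtain ⟨a, ha, hxa⟩ := hA
      obtain ⟨b, hb, hxb⟩ := hB
      obtain ⟨h, hh, hxh⟩ := (hHm a b x).2 ⟨hxa, hxb⟩
      exact ⟨h, by simp only [Set.mem_iUnion]; exact ⟨a, ha, b, hb, hh⟩, hxh⟩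
    · rintro ⟨h, hh, hxh⟩
      simp only [Set.mem_iUnion] at hh
      obtain ⟨a, ha, b, hb, hh⟩ := hh
      obtain ⟨hxa, hxb⟩ := (hHm a b x).1 ⟨h, hh, hxh⟩
      rw [hFd, hGd]
      exact ⟨⟨a, ha, hxa⟩, b, hb, hxb⟩
  have hsub : ∀ h ∈ ⋃ a ∈ F, ⋃ b ∈ G, H a b, h ∈ A.carrier := fun h hh => by
    have : h ∈ A.carrier ∩ B.carrier := by rw [hd]; exact ⟨h, hh, le_rfl⟩
    exact this.1
  -- `D(S)` requires a nonempty generating set; some generator lies above 0.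
  have h0 : (0 : S) ∈ A.carrier ∩ B.carrier := ⟨A.zero_mem, B.zero_mem⟩
  refine ⟨⟨A.carrier ∩ B.carrier, _, hF.biUnion fun a _ => hG.biUnion fun b _ => hH a b, ?_,
    fun x hx y hy => A.compat (hsub x hx) (hsub y hy), hd⟩, rfl⟩
  rw [hd] at h0
  obtain ⟨h, hh, -⟩ := h0
  exact ⟨h, hh⟩

theorem isMeetSemigroup (hS : IsWeakSemilattice S) :
    IsMeetSemigroup (DistributiveCompletion S) := by
  intro A B
  obtain ⟨C, hC⟩ := exists_inter hS A B
  refine ⟨C, ?_, fun D hD => ?_⟩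
  · rintro _ (rfl | rfl)
    · exact le_iff.2 (hC ▸ Set.inter_subset_left)
    · exact le_iff.2 (hC ▸ Set.inter_subset_right)
  · exact le_iff.2 (hC ▸ Set.subset_inter (le_iff.1 (hD (by simp))) (le_iff.1 (hD (by simp))))

end DistributiveCompletion

/-! ### Recovering finite generation in `S` from a meet in `B(S)`. -/

open DistributiveCompletion DistributiveBooleanization in
theorem isWeakSemilattice_of_isMeetSemigroup_booleanization {S : Type*}
    [InverseSemigroupWithZero S] (h : IsMeetSemigroup (Booleanization S)) :
    IsWeakSemilattice S := by
  intro a b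
  obtain ⟨M, hM⟩ := h (of (principal a)) (of (principal b))
  have hMc := carrier_of_isGLB hM
  obtain ⟨F, hF, hFV, -, hMF⟩ := M.isFiniteJoin
  have hmem : ∀ (c : S) (hc : c ≠ 0),
      -- The point filters translate the finite decomposition of `M` into a description of the
      -- nonzero common lower bounds.
      (∃ Y ∈ F, principalFilter c hc ∈ Y.carrier) ↔ c ≤ a ∧ c ≤ b := by
    intro c hc
    have h1 : principalFilter c hc ∈ M.val.carrier ↔ c ≤ a ∧ c ≤ b := by
      rw [hMc]
      exact and_congr mem_principal mem_principal
    rw [← h1, hMF]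
    simp
  have hgen : ∀ Y ∈ F, ∃ G : Set S, G.Finite ∧ (∀ g ∈ G, g ≤ a ∧ g ≤ b) ∧
      ∀ (c : S) (hc : c ≠ 0), principalFilter c hc ∈ Y.carrier → ∃ g ∈ G, c ≤ g := by
    intro Y hY
    obtain ⟨s, t, -, rfl⟩ := hFV Y hY
    obtain ⟨G, hG, -, -, hGd⟩ := s.exists_generators
    -- A retained generator lies in s \ t, so its own point filter belongs to `Y` and it is a common
    -- lower bound. Conversely, a generator above an element outside `t` is itself outside `t`,
    -- because `t` is an order ideal.
    refine ⟨{g ∈ G | g ∉ t.carrier}, hG.subset (Set.sep_subset _ _), ?_, ?_⟩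
    · rintro g ⟨hg, hgt⟩
      have hg0 : g ≠ 0 := fun h0 => hgt (h0 ▸ t.zero_mem)
      exact (hmem g hg0).1 ⟨_, hY, by rw [mem_principalFilter, hGd]; exact ⟨g, hg, le_rfl⟩, hgt⟩
    · rintro c hc ⟨hcs, hct⟩
      rw [mem_principalFilter, hGd] at hcs
      obtain ⟨g, hg, hcg⟩ := hcs
      exact ⟨g, ⟨hg, fun hgt => hct (t.lower hcg hgt)⟩, hcg⟩
  choose! G hG hGle hGc using hgen
  -- Point filters exist only for nonzero elements, so the lower bound 0 is added by hand.
  refine ⟨insert 0 (⋃ Y ∈ F, G Y), (hF.biUnion hG).insert 0, ?_⟩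
  ext c
  have hab : c ∈ downSet {a} ∩ downSet {b} ↔ c ≤ a ∧ c ≤ b :=
    and_congr mem_principal mem_principal
  rw [hab]
  constructor
  · intro hc
    by_cases hc0 : c = 0
    · exact ⟨0, Set.mem_insert _ _, hc0.le⟩
    · obtain ⟨Y, hY, hYc⟩ := (hmem c hc0).2 hc
      obtain ⟨g, hg, hcg⟩ := hGc Y hY c hc0 hYc
      exact ⟨g, Set.mem_insert_of_mem _ (Set.mem_biUnion hY hg), hcg⟩
  · rintro ⟨g, rfl | hg, hcg⟩
    · exact ⟨hcg.trans (zero_le' a), hcg.trans (zero_le' b)⟩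
    · simp only [Set.mem_iUnion] at hg
      obtain ⟨Y, hY, hg⟩ := hg
      have := hGle Y hY g hg
      exact ⟨hcg.trans this.1, hcg.trans this.2⟩

theorem mainTheorem7 {S : Type*} [InverseSemigroupWithZero S] :
    IsWeakSemilattice S ↔ IsMeetSemigroup (Booleanization S) :=
  ⟨fun h => DistributiveBooleanization.isMeetSemigroup (DistributiveCompletion.isMeetSemigroup h),
    isWeakSemilattice_of_isMeetSemigroup_booleanization⟩
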